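/- Let $\alpha=(\sqrt5-1)/2$, let $q_n$ be the $n$-th Fibonacci number ($q_1=q_2=1$, $q_{n+1}=q_n+q_{n-1}$), let $g'(x)=-\pi\csc^2(\pi x)$, and write $S_N(\theta)=\sum_{k=1}^{N} g'(\theta+k\alpha)$. There is $\delta>0$ such that for every real $y$ with $|y|<\delta$ and every $x\in[0,1]$ the limits $$ s'_{y,\mathrm{even}}(x)=\lim_{m\to\infty}\frac{S_{\lfloor x q_{2m}\rfloor}(y/q_{2m})}{q_{2m}^2},\qquad s'_{y,\mathrm{odd}}(x)=\lim_{m\to\infty}\frac{S_{\lfloor x q_{2m+1}\rfloor}(y/q_{2m+1})}{q_{2m+1}^2} $$ exist, and $s'_{y,\mathrm{even}}$ and $s'_{y,\mathrm{odd}}$ are monotone (nonincreasing) functions on $[0,1]$. For $y=0$ the even and odd limits agree up to their values at jumps: there is a nonincreasing function $s'$ on $[0,1]$, continuous from the right on $[0,1)$, such that $s'_{0,\mathrm{even}}(x)=s'_{0,\mathrm{odd}}(x)=s'(x)$ for every $x\in[0,1]$ outside the countable set $\{a+b\alpha : a,b\in\mathbb Z\}\cap(0,1)$, and $$ s'(\alpha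 x)=\alpha^2 s'(x)\qquad\text{for all } x\in[0,1]. $$ -/

import Mathlib

open Filter Topology

noncomputable section

/-- The golden rotation number `α = (√5 - 1) / 2`. -/
def goldenAlpha : ℝ := (Real.sqrt 5 - 1) / 2

/-- The derivative `g'(x) = -π csc² (π x)` of `g(x) = cot (π x)`. -/
def cotDeriv (x : ℝ) : ℝ := -Real.pi * (1 / Real.sin (Real.pi * x)) ^ 2

/-- The Birkhoff sum `S_N(θ) = ∑_{k=1}^{N} g'(θ + k α)` for the golden rotation. -/
def cscBirkhoffSum (N : ℕ) (θ : ℝ) : ℝ :=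
  ∑ k ∈ Finset.Icc 1 N, cotDeriv (θ + k * goldenAlpha)

/-- The rescaled Birkhoff sum `S_{[x q_n]}(y / q_n) / q_n²`, with `q_n` the `n`-th Fibonacci number
(`q_1 = q_2 = 1`) and `[·]` the integer part. -/
def scaledCscSum (n : ℕ) (y x : ℝ) : ℝ :=
  cscBirkhoffSum ⌊x * (Nat.fib n : ℝ)⌋₊ (y / (Nat.fib n : ℝ)) / (Nat.fib n : ℝ) ^ 2

/-- The countable set `ℤ[α] = {a + b α : a, b ∈ ℤ}`. -/
def goldenIntegers : Set ℝ := {x | ∃ a b : ℤ, x = a + b * goldenAlpha}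

end

/-! The scaled sum is a lattice sum over `ℤ[α]`, seen through its two real embeddings v
(`goldenVal`) and v* (`goldenStar`). The residue of kα nearest to 0 is some j + kα, and, α being a
unit, it can be written as αⁿv. Since k√5 is the difference of the two embeddings of j + kα and q_n
~ (1 + α)ⁿ/√5, the condition 1 ≤ k ≤ x q_n becomes, in the limit, a window 0 < -σv* ≤ x with σ =
(-1)ⁿ. Only the endpoint v* = -σx needs a finer test (`eventually_isNearPoint_iff`). As q_n αⁿ →
1/√5, the summand tends to -π/(π(y + v/√5))² (`tendsto_scaledTerm`).

Dominated convergence gives the limit of the sum. The majorant is a multiple of 1/v² on a strip |v*|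
≤ 5/2, summable because vv* is a nonzero integer and the strip holds boundedly many points per
second coordinate (`summable_stripInvSq`, `norm_scaledTerm_le`). Monotonicity passes to the limit,
all summands being nonpositive.

At y = 0 the summand is even in v, so p ↦ -p exchanges the two parities away from endpoint ties.
Multiplication by -α rescales the window and the summand, which is the self-similarity. -/

lemma goldenAlpha_sq : goldenAlpha ^ 2 = 1 - goldenAlpha := by
  have h := Real.sq_sqrt (show (0 : ℝ) ≤ 5 by norm_num)
  unfold goldenAlpha
  linarith [h, show ((√5 - 1) / 2) ^ 2 = (√5 ^ 2 - 2 * √5 + 1) / 4 by ring]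

lemma three_fifths_lt_goldenAlpha : 3 / 5 < goldenAlpha := by
  have h : (2.2 : ℝ) < √5 := Real.lt_sqrt_of_sq_lt (by norm_num)
  unfold goldenAlpha
  linarith

lemma goldenAlpha_lt_five_eighths : goldenAlpha < 5 / 8 := by
  have h : √5 < (9 / 4 : ℝ) := (Real.sqrt_lt' (by norm_num)).2 (by norm_num)
  unfold goldenAlpha
  linarith

lemma goldenAlpha_pos : 0 < goldenAlpha := by linarith [three_fifths_lt_goldenAlpha]

lemma goldenAlpha_lt_one : goldenAlpha < 1 := by linarith [goldenAlpha_lt_five_eighths]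

lemma irrational_goldenAlpha : Irrational goldenAlpha := by
  have h : goldenAlpha = -Real.goldenConj := by
    unfold goldenAlpha Real.goldenConj
    ring
  rw [h]
  exact Real.goldenConj_irrational.neg

lemma one_add_goldenAlpha_pow_mul (n : ℕ) : (1 + goldenAlpha) ^ n * goldenAlpha ^ n = 1 := by
  rw [← mul_pow, show (1 + goldenAlpha) * goldenAlpha = 1 by linarith [goldenAlpha_sq], one_pow]

lemma fib_mul_two_goldenAlpha_add_one (n : ℕ) :
    (Nat.fib n : ℝ) * (2 * goldenAlpha + 1) =
      (1 + goldenAlpha) ^ n - (-1) ^ n * goldenAlpha ^ n := by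
  have h := Real.coe_fib_eq n
  have h1 : Real.goldenRatio = 1 + goldenAlpha := by
    unfold goldenAlpha Real.goldenRatio
    ring
  have h2 : Real.goldenConj = -goldenAlpha := by
    unfold goldenAlpha Real.goldenConj
    ring
  have h3 : 2 * goldenAlpha + 1 = √5 := by
    unfold goldenAlpha
    ring
  rw [h, h1, h2, h3, div_mul_cancel₀ _ (by positivity), neg_pow goldenAlpha]

/-! ### The ring `ℤ[α]` and its two embeddings -/

/-- The embedding `(a, b) ↦ a + b α` of `ℤ[α]` in `ℝ`. -/
noncomputable def goldenVal (p : ℤ × ℤ) : ℝ := p.1 + p.2 * goldenAlpha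

/-- The conjugate embedding `(a, b) ↦ a - b (1 + α)` of `ℤ[α]` in `ℝ`. -/
noncomputable def goldenStar (p : ℤ × ℤ) : ℝ := p.1 - p.2 * (1 + goldenAlpha)

/-- Multiplication by `α` in the coordinates of `ℤ[α]`. -/
def goldenMul : Equiv.Perm (ℤ × ℤ) where
  toFun p := (p.2, p.1 - p.2)
  invFun p := (p.1 + p.2, p.1)
  left_inv p := by simp
  right_inv p := by simp

lemma goldenVal_goldenMul (p : ℤ × ℤ) : goldenVal (goldenMul p) = goldenAlpha * goldenVal p := by
  simp only [goldenVal, goldenMul, Equiv.coe_fn_mk]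
  push_cast
  linear_combination (-(p.2 : ℝ)) * goldenAlpha_sq

lemma goldenStar_goldenMul (p : ℤ × ℤ) :
    goldenStar (goldenMul p) = -(1 + goldenAlpha) * goldenStar p := by
  simp only [goldenStar, goldenMul, Equiv.coe_fn_mk]
  push_cast
  linear_combination (-(p.2 : ℝ)) * goldenAlpha_sq

lemma goldenVal_goldenMul_pow (n : ℕ) (p : ℤ × ℤ) :
    goldenVal ((goldenMul ^ n) p) = goldenAlpha ^ n * goldenVal p := by
  induction n with
  | zero => simp
  | succ n ih => rw [pow_succ', Equiv.Perm.mul_apply, goldenVal_goldenMul, ih]; ring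

lemma goldenStar_goldenMul_pow (n : ℕ) (p : ℤ × ℤ) :
    goldenStar ((goldenMul ^ n) p) = (-1) ^ n * (1 + goldenAlpha) ^ n * goldenStar p := by
  induction n with
  | zero => simp
  | succ n ih => rw [pow_succ', Equiv.Perm.mul_apply, goldenStar_goldenMul, ih]; ring

lemma goldenVal_neg (p : ℤ × ℤ) : goldenVal (-p) = -goldenVal p := by
  simp [goldenVal]; ring

lemma goldenStar_neg (p : ℤ × ℤ) : goldenStar (-p) = -goldenStar p := by
  simp [goldenStar]; ring

lemma goldenVal_sub_goldenStar (p : ℤ × ℤ) :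
    goldenVal p - goldenStar p = p.2 * (2 * goldenAlpha + 1) := by
  simp only [goldenVal, goldenStar]; ring

lemma goldenVal_eq_zero {p : ℤ × ℤ} (h : goldenVal p = 0) : p = 0 := by
  obtain ⟨a, b⟩ := p
  simp only [goldenVal] at h
  by_cases hb : b = 0
  · subst hb
    simpa using h
  · exact absurd h ((irrational_goldenAlpha.intCast_mul hb).intCast_add a).ne_zero

lemma goldenStar_eq_zero {p : ℤ × ℤ} (h : goldenStar p = 0) : p = 0 := by
  obtain ⟨a, b⟩ := p
  have h' : goldenVal (a - b, -b) = 0 := by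
    simp only [goldenVal, goldenStar] at h ⊢
    push_cast
    linarith
  have := goldenVal_eq_zero h'
  simp only [Prod.mk_eq_zero, neg_eq_zero] at this ⊢
  omega

/-- The product is the norm a² - ab - b², a nonzero integer. -/
lemma one_le_abs_goldenVal_mul_abs_goldenStar {p : ℤ × ℤ} (hp : p ≠ 0) :
    1 ≤ |goldenVal p| * |goldenStar p| := by
  have h : goldenVal p * goldenStar p = ((p.1 ^ 2 - p.1 * p.2 - p.2 ^ 2 : ℤ) : ℝ) := by
    simp only [goldenVal, goldenStar]
    push_cast
    linear_combination (-(p.2 : ℝ) ^ 2) * goldenAlpha_sq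
  have h0 : goldenVal p * goldenStar p ≠ 0 :=
    mul_ne_zero (fun h => hp (goldenVal_eq_zero h)) (fun h => hp (goldenStar_eq_zero h))
  rw [← abs_mul, h, ← Int.cast_abs]
  rw [h] at h0
  exact_mod_cast Int.one_le_abs (by exact_mod_cast h0)

/-! ### The summable majorant -/

/-- The summable majorant: `1 / μ²` on nonzero `μ ∈ ℤ[α]` whose conjugate is at most `5 / 2`. -/
noncomputable def stripInvSq (p : ℤ × ℤ) : ℝ :=
  open Classical in if p ≠ 0 ∧ |goldenStar p| ≤ 5 / 2 then 1 / goldenVal p ^ 2 else 0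

lemma stripInvSq_nonneg (p : ℤ × ℤ) : 0 ≤ stripInvSq p := by
  unfold stripInvSq
  split_ifs <;> positivity

lemma two_fifths_le_abs_goldenVal {p : ℤ × ℤ} (hp : p ≠ 0) (h : |goldenStar p| ≤ 5 / 2) :
    2 / 5 ≤ |goldenVal p| := by
  nlinarith [one_le_abs_goldenVal_mul_abs_goldenStar hp, abs_nonneg (goldenVal p)]

lemma one_add_sq_le_goldenVal_sq {p : ℤ × ℤ} (hp : p ≠ 0) (h : |goldenStar p| ≤ 5 / 2) :
    1 + (p.2 : ℝ) ^ 2 ≤ 25 * goldenVal p ^ 2 := by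
  have h1 := two_fifths_le_abs_goldenVal hp h
  have h2 : |(p.2 : ℝ)| * 2 ≤ |goldenVal p| + 5 / 2 := by
    have h3 : |(p.2 : ℝ)| * (2 * goldenAlpha + 1) ≤ |goldenVal p| + |goldenStar p| := by
      rw [← abs_of_pos (show 0 < 2 * goldenAlpha + 1 by linarith [goldenAlpha_pos]), ← abs_mul,
        ← goldenVal_sub_goldenStar]
      exact abs_sub _ _
    nlinarith [abs_nonneg (p.2 : ℝ), three_fifths_lt_goldenAlpha]
  have h4 : |(p.2 : ℝ)| ≤ 4 * |goldenVal p| := by linarith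
  have h5 := pow_le_pow_left₀ (abs_nonneg _) h4 2
  have h6 := pow_le_pow_left₀ (by norm_num) h1 2
  rw [mul_pow, sq_abs, sq_abs] at h5
  rw [sq_abs] at h6
  linarith

lemma summable_stripInvSq : Summable stripInvSq := by
  -- This shear brings the conjugate within 1 of the first coordinate, so the strip lies in finitely
  -- many rows, each dominated by 25 / (1 + b²).
  let e : ℤ × ℤ ≃ ℤ × ℤ :=
    { toFun := fun p => (p.1 + ⌊(p.2 : ℝ) * (1 + goldenAlpha)⌋, p.2)
      invFun := fun p => (p.1 - ⌊(p.2 : ℝ) * (1 + goldenAlpha)⌋, p.2)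
      left_inv := fun p => by simp
      right_inv := fun p => by simp }
  have hu : Summable fun i : ℤ => if i ∈ Finset.Icc (-4 : ℤ) 4 then (25 : ℝ) else 0 :=
    summable_of_ne_finset_zero (s := Finset.Icc (-4 : ℤ) 4) fun i hi => if_neg hi
  have hw : Summable fun b : ℤ => 1 / (1 + (b : ℝ) ^ 2) := by
    refine Summable.of_nonneg_of_le (fun b => by positivity) (fun b => ?_)
      ((Real.summable_one_div_int_pow.2 one_lt_two).add
        (summable_of_ne_finset_zero (f := fun b : ℤ => if b ∈ ({0} : Finset ℤ) then (1 : ℝ) else 0)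
          (s := {0}) fun i hi => if_neg hi))
    by_cases hb : b = 0
    · simp [hb]
    · simp only [Finset.mem_singleton, hb, if_false, add_zero]
      have : (b : ℝ) ≠ 0 := by exact_mod_cast hb
      gcongr
      linarith
  have hm := hu.mul_of_nonneg hw (fun i => by dsimp only; split_ifs <;> norm_num)
    (fun b => by dsimp only [Pi.zero_apply]; positivity)
  rw [← e.summable_iff]
  refine Summable.of_nonneg_of_le (fun p => stripInvSq_nonneg _) (fun p => ?_) hm
  simp only [Function.comp, stripInvSq]
  split_ifs with h1 h2 h2
  · have hb : (e p).2 = p.2 := rfl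
    have h3 := one_add_sq_le_goldenVal_sq h1.1 h1.2
    rw [hb] at h3
    have hv : 0 < goldenVal (e p) ^ 2 := by nlinarith [sq_nonneg (p.2 : ℝ)]
    rw [mul_one_div, div_le_div_iff₀ hv (by positivity)]
    linarith
  · exfalso
    apply h2
    have h3 := abs_le.1 h1.2
    have h4 : goldenStar (e p) = p.1 + ⌊(p.2 : ℝ) * (1 + goldenAlpha)⌋
        - p.2 * (1 + goldenAlpha) := by
      simp [goldenStar, e]
    rw [h4] at h3
    have h5 := Int.floor_le ((p.2 : ℝ) * (1 + goldenAlpha))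
    have h6 := Int.lt_floor_add_one ((p.2 : ℝ) * (1 + goldenAlpha))
    rw [Finset.mem_Icc]
    constructor
    · have : (-4 : ℝ) ≤ p.1 := by linarith [h3.1]
      exact_mod_cast this
    · have : (p.1 : ℝ) ≤ 4 := by linarith [h3.2]
      exact_mod_cast this
  · positivity
  · simp

/-! ### The Birkhoff sum as a lattice sum -/

lemma cotDeriv_add_int (x : ℝ) (j : ℤ) : cotDeriv (x + j) = cotDeriv x := by
  have h : Real.pi * (x + j) = Real.pi * x + j * Real.pi := by ring
  simp only [cotDeriv, h, Real.sin_add_int_mul_pi, div_pow, mul_pow, one_pow]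
  rw [← zpow_natCast ((-1 : ℝ) ^ j), ← zpow_mul, mul_comm j, zpow_mul]
  simp

/-- The lattice points `j + k α` with `1 ≤ k ≤ N` that are nearest to `0` modulo `1`. -/
def IsNearPoint (N : ℕ) (p : ℤ × ℤ) : Prop :=
  1 ≤ p.2 ∧ p.2 ≤ N ∧ |goldenVal p| < 1 / 2

open Classical in
-- Each k has exactly one near point, with j = -round(kα): irrationality of α rules out distance
-- 1/2.
lemma cscBirkhoffSum_eq_tsum (N n : ℕ) (θ : ℝ) :
    cscBirkhoffSum N θ = ∑' p, if IsNearPoint N ((goldenMul ^ n) p)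
      then cotDeriv (θ + goldenAlpha ^ n * goldenVal p) else 0 := by
  simp only [← goldenVal_goldenMul_pow]
  rw [(goldenMul ^ n).tsum_eq (fun q => if IsNearPoint N q then cotDeriv (θ + goldenVal q) else 0)]
  have hinj : Function.Injective fun k : ℕ => (-round ((k : ℝ) * goldenAlpha), (k : ℤ)) :=
    fun k l h => by simpa using (Prod.ext_iff.1 h).2
  rw [tsum_eq_sum (s := (Finset.Icc 1 N).map ⟨_, hinj⟩), Finset.sum_map, cscBirkhoffSum]
  · refine Finset.sum_congr rfl fun k hk => ?_
    rw [Finset.mem_Icc] at hk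
    have hv : goldenVal (-round ((k : ℝ) * goldenAlpha), (k : ℤ)) =
        k * goldenAlpha - round ((k : ℝ) * goldenAlpha) := by
      simp only [goldenVal]; push_cast; ring
    have hk0 : k ≠ 0 := by omega
    have hirr := irrational_goldenAlpha.natCast_mul hk0
    rw [Function.Embedding.coeFn_mk, if_pos, hv]
    · rw [← cotDeriv_add_int _ (-round ((k : ℝ) * goldenAlpha))]
      congr 1
      push_cast
      ring
    · refine ⟨Int.ofNat_le.2 hk.1, Int.ofNat_le.2 hk.2, ?_⟩
      rw [hv]
      refine lt_of_le_of_ne (abs_sub_round _) fun h => ?_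
      rcases eq_or_eq_neg_of_abs_eq h with h | h
      · refine hirr ⟨round ((k : ℝ) * goldenAlpha) + 1 / 2, ?_⟩
        push_cast
        linarith
      · refine hirr ⟨round ((k : ℝ) * goldenAlpha) - 1 / 2, ?_⟩
        push_cast
        linarith
  · rintro ⟨j, k⟩ hq
    refine if_neg fun ⟨h1, h2, h3⟩ => hq ?_
    dsimp only at h1 h2
    obtain ⟨k, rfl⟩ := Int.eq_ofNat_of_zero_le (by omega : 0 ≤ k)
    rw [Finset.mem_map]
    refine ⟨k, Finset.mem_Icc.2 ⟨by omega, by omega⟩, ?_⟩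
    simp only [Function.Embedding.coeFn_mk, Prod.mk.injEq, and_true]
    simp only [goldenVal] at h3
    have h4 := abs_sub_round ((k : ℝ) * goldenAlpha)
    rw [abs_lt] at h3
    rw [abs_le] at h4
    push_cast at h3
    have h5 : ((j + round ((k : ℝ) * goldenAlpha) : ℤ) : ℝ) < 1 := by push_cast; linarith
    have h6 : (-1 : ℝ) < ((j + round ((k : ℝ) * goldenAlpha) : ℤ) : ℝ) := by push_cast; linarith
    have h7 : j + round ((k : ℝ) * goldenAlpha) < 1 := by exact_mod_cast h5
    have h8 : -1 < j + round ((k : ℝ) * goldenAlpha) := by exact_mod_cast h6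
    omega

/-! ### Uniform domination -/

/-- Jordan's inequality, reflected beyond 1/2. The range exceeds 1/2 to leave room for the shift
y/q_n. -/
lemma two_thirds_mul_abs_le_abs_sin {t : ℝ} (ht : |t| ≤ 3 / 4) :
    2 / 3 * |t| ≤ |Real.sin (Real.pi * t)| := by
  have hπ := Real.pi_pos
  have key : ∀ u : ℝ, 0 ≤ u → u ≤ 1 / 2 → 2 * u ≤ Real.sin (Real.pi * u) := fun u h0 h1 => by
    have := Real.mul_le_sin (x := Real.pi * u) (by positivity) (by nlinarith)
    rwa [show 2 / Real.pi * (Real.pi * u) = 2 * u by field_simp] at this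
  have habs : |Real.sin (Real.pi * t)| = |Real.sin (Real.pi * |t|)| := by
    rcases abs_cases t with h | h <;> simp [h.1]
  rw [habs]
  refine le_trans ?_ (le_abs_self _)
  have h0 := abs_nonneg t
  rcases le_total |t| (1 / 2) with h | h
  · linarith [key |t| h0 h]
  · have := key (1 - |t|) (by linarith) (by linarith)
    rw [mul_sub Real.pi, mul_one, Real.sin_pi_sub] at this
    linarith

lemma fib_mul_goldenAlpha_pow (n : ℕ) :
    (Nat.fib n : ℝ) * goldenAlpha ^ n =
      (1 - (-1) ^ n * (goldenAlpha ^ 2) ^ n) / (2 * goldenAlpha + 1) := by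
  rw [eq_div_iff (by linarith [goldenAlpha_pos])]
  linear_combination goldenAlpha ^ n * fib_mul_two_goldenAlpha_add_one n
    + one_add_goldenAlpha_pow_mul n

lemma one_fourth_le_fib_mul_goldenAlpha_pow {n : ℕ} (hn : n ≠ 0) :
    1 / 4 ≤ (Nat.fib n : ℝ) * goldenAlpha ^ n := by
  have h0 := three_fifths_lt_goldenAlpha
  have h1 := goldenAlpha_lt_five_eighths
  have h2 : (-1) ^ n * (goldenAlpha ^ 2) ^ n ≤ goldenAlpha ^ 2 := by
    refine (le_abs_self _).trans ?_
    rw [abs_mul, abs_pow, abs_neg, abs_one, one_pow, one_mul, abs_of_nonneg (by positivity)]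
    exact pow_le_of_le_one (sq_nonneg _) (by nlinarith) hn
  rw [fib_mul_goldenAlpha_pow, div_le_div_iff₀ (by norm_num) (by linarith)]
  nlinarith [goldenAlpha_sq]

/-- The `p`-th term of the rescaled Birkhoff sum, written over `ℤ[α]`. -/
noncomputable def scaledTerm (n : ℕ) (y x : ℝ) (p : ℤ × ℤ) : ℝ :=
  open Classical in
  if IsNearPoint ⌊x * (Nat.fib n : ℝ)⌋₊ ((goldenMul ^ n) p) then
    cotDeriv (y / Nat.fib n + goldenAlpha ^ n * goldenVal p) / (Nat.fib n : ℝ) ^ 2 else 0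

lemma scaledCscSum_eq_tsum (n : ℕ) (y x : ℝ) :
    scaledCscSum n y x = ∑' p, scaledTerm n y x p := by
  rw [scaledCscSum, cscBirkhoffSum_eq_tsum _ n, ← tsum_div_const]
  congr 1 with p
  rw [scaledTerm]
  split_ifs <;> simp

lemma norm_scaledTerm_le {n : ℕ} (hn : n ≠ 0) {y x : ℝ} (hy : |y| < 1 / 20) (hx : x ≤ 1)
    (p : ℤ × ℤ) : ‖scaledTerm n y x p‖ ≤ 144 * Real.pi * stripInvSq p := by
  have hπ := Real.pi_pos
  unfold scaledTerm
  split_ifs with h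
  swap
  · rw [norm_zero]
    exact mul_nonneg (by positivity) (stripInvSq_nonneg p)
  obtain ⟨h1, h2, h3⟩ := h
  have hα := goldenAlpha_pos
  have hq : (1 : ℝ) ≤ Nat.fib n := by exact_mod_cast Nat.fib_pos.2 (Nat.pos_of_ne_zero hn)
  have hpow : 0 < goldenAlpha ^ n := by positivity
  have hpow1 : goldenAlpha ^ n ≤ 1 := pow_le_one₀ hα.le goldenAlpha_lt_one.le
  have hpowb := one_add_goldenAlpha_pow_mul n
  have hk1 : (1 : ℝ) ≤ ((goldenMul ^ n) p).2 := by exact_mod_cast h1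
  have hkN : (((goldenMul ^ n) p).2 : ℝ) ≤ Nat.fib n := by
    have hN : ⌊x * (Nat.fib n : ℝ)⌋₊ ≤ Nat.fib n :=
      Nat.floor_le_of_le (mul_le_of_le_one_left (by linarith) hx)
    exact_mod_cast h2.trans (by exact_mod_cast hN)
  have hp : p ≠ 0 := by
    rintro rfl
    have := goldenVal_sub_goldenStar ((goldenMul ^ n) 0)
    rw [goldenVal_goldenMul_pow, goldenStar_goldenMul_pow] at this
    simp only [goldenVal, goldenStar, Prod.fst_zero, Prod.snd_zero, Int.cast_zero] at this
    nlinarith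
  have hstar : |goldenStar p| ≤ 5 / 2 := by
    have e1 := goldenVal_sub_goldenStar ((goldenMul ^ n) p)
    have e2 : |goldenStar ((goldenMul ^ n) p)| = (1 + goldenAlpha) ^ n * |goldenStar p| := by
      rw [goldenStar_goldenMul_pow, abs_mul, abs_mul, abs_pow, abs_neg, abs_one, one_pow, one_mul,
        abs_of_pos (by positivity)]
    have e3 : |goldenStar p| = goldenAlpha ^ n * |goldenStar ((goldenMul ^ n) p)| := by
      rw [e2]; linear_combination (-|goldenStar p|) * hpowb
    have e4 : |goldenStar ((goldenMul ^ n) p)| ≤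
        1 / 2 + (1 + goldenAlpha) ^ n + goldenAlpha ^ n := by
      have e5 : (((goldenMul ^ n) p).2 : ℝ) * (2 * goldenAlpha + 1) ≤
          (1 + goldenAlpha) ^ n + goldenAlpha ^ n := by
        refine (mul_le_mul_of_nonneg_right hkN (by linarith)).trans ?_
        rw [fib_mul_two_goldenAlpha_add_one]
        rcases neg_one_pow_eq_or ℝ n with h | h <;> rw [h] <;> linarith
      have e6 : 0 ≤ (((goldenMul ^ n) p).2 : ℝ) * (2 * goldenAlpha + 1) :=
        mul_nonneg (by linarith) (by linarith)
      have e7 : 0 < (1 + goldenAlpha) ^ n := by positivity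
      rw [abs_lt] at h3
      rw [abs_le]
      constructor <;> linarith
    -- Since αⁿ(1 + α)ⁿ = 1 and αⁿ ≤ 1, the bound is at most 1/2 + 1 + 1, the width of the strip.
    rw [e3]
    refine (mul_le_mul_of_nonneg_left e4 hpow.le).trans ?_
    nlinarith
  have hv := two_fifths_le_abs_goldenVal hp hstar
  have hc := one_fourth_le_fib_mul_goldenAlpha_pow hn
  have hq0 : (Nat.fib n : ℝ) ≠ 0 := by positivity
  set t := y / Nat.fib n + goldenAlpha ^ n * goldenVal p with ht
  -- Here |y| < 1/20 = (2/5)/8 ≤ |v|/8, so the shift costs at most half of |v|/4.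
  have hqt : |goldenVal p| / 8 ≤ Nat.fib n * |t| := by
    have e1 : Nat.fib n * t = y + Nat.fib n * goldenAlpha ^ n * goldenVal p := by
      rw [ht]; field_simp
    rw [← abs_of_pos (show (0 : ℝ) < Nat.fib n by linarith), ← abs_mul, e1]
    have e2 := abs_sub_abs_le_abs_sub (Nat.fib n * goldenAlpha ^ n * goldenVal p) (-y)
    rw [sub_neg_eq_add, add_comm _ y, abs_neg, abs_mul, abs_of_pos (by linarith)] at e2
    have e3 := mul_le_mul_of_nonneg_right hc (abs_nonneg (goldenVal p))
    linarith
  have ht34 : |t| ≤ 3 / 4 := by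
    refine (abs_add_le _ _).trans ?_
    rw [goldenVal_goldenMul_pow] at h3
    have : |y / Nat.fib n| ≤ |y| := by
      rw [abs_div, abs_of_pos (show (0 : ℝ) < Nat.fib n by linarith)]
      exact div_le_self (abs_nonneg _) hq
    linarith
  have hsin := two_thirds_mul_abs_le_abs_sin ht34
  have hfin : |goldenVal p| / 12 ≤ Nat.fib n * |Real.sin (Real.pi * t)| := by nlinarith
  have hsq := pow_le_pow_left₀ (by positivity) hfin 2
  rw [div_pow, mul_pow, sq_abs, sq_abs] at hsq
  have hv2 : 0 < goldenVal p ^ 2 := by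
    rw [← sq_abs]
    exact pow_pos (by linarith) 2
  rw [stripInvSq, if_pos ⟨hp, hstar⟩, cotDeriv, norm_div, norm_mul, norm_neg, norm_pow, norm_pow,
    Real.norm_of_nonneg hπ.le, Real.norm_eq_abs, Real.norm_eq_abs, sq_abs, sq_abs, div_pow, one_pow,
    mul_one_div, mul_one_div, div_div, mul_comm (Real.sin _ ^ 2)]
  rw [div_le_div_iff₀ (by linarith) hv2]
  nlinarith

/-! ### Termwise limits -/

/-- The points of `ℤ[α]` that contribute to the limit at `x` along indices of parity sign `σ`. -/
def GoldenWindow (σ x : ℝ) (p : ℤ × ℤ) : Prop :=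
  σ * goldenStar p < 0 ∧
    (0 < x + σ * goldenStar p ∨ x + σ * goldenStar p = 0 ∧ goldenVal p + σ * x ≤ 0)

/-- Both bounds on k are multiplied by αⁿ(2α + 1), after which n enters only through αⁿ and the
sign. -/
lemma isNearPoint_goldenMul_pow_iff (n : ℕ) {x : ℝ} (hx : 0 ≤ x) (p : ℤ × ℤ) :
    IsNearPoint ⌊x * (Nat.fib n : ℝ)⌋₊ ((goldenMul ^ n) p) ↔
      0 < (goldenAlpha ^ n) ^ 2 * goldenVal p - (-1) ^ n * goldenStar p ∧
      (goldenAlpha ^ n) ^ 2 * (goldenVal p + (-1) ^ n * x) ≤ x + (-1) ^ n * goldenStar p ∧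
      |goldenAlpha ^ n * goldenVal p| < 1 / 2 := by
  have hα := goldenAlpha_pos
  have hpow : 0 < goldenAlpha ^ n := by positivity
  have hr : 0 < 2 * goldenAlpha + 1 := by linarith
  have hab := one_add_goldenAlpha_pow_mul n
  have hk := goldenVal_sub_goldenStar ((goldenMul ^ n) p)
  rw [goldenVal_goldenMul_pow, goldenStar_goldenMul_pow] at hk
  have hf := fib_mul_two_goldenAlpha_add_one n
  set k := ((goldenMul ^ n) p).2 with hkdef
  have h1 : (1 ≤ k) ↔ 0 < (goldenAlpha ^ n) ^ 2 * goldenVal p - (-1) ^ n * goldenStar p := by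
    have e : (goldenAlpha ^ n) ^ 2 * goldenVal p - (-1) ^ n * goldenStar p =
        (goldenAlpha ^ n * (2 * goldenAlpha + 1)) * k := by
      linear_combination goldenAlpha ^ n * hk + (-1) ^ n * goldenStar p * hab
    rw [e, mul_pos_iff_of_pos_left (by positivity), Int.cast_pos]
    rfl
  have h2 : 1 ≤ k → ((k ≤ (⌊x * (Nat.fib n : ℝ)⌋₊ : ℤ)) ↔
      (goldenAlpha ^ n) ^ 2 * (goldenVal p + (-1) ^ n * x) ≤ x + (-1) ^ n * goldenStar p) := by
    intro hk1
    have e : x + (-1) ^ n * goldenStar p - (goldenAlpha ^ n) ^ 2 * (goldenVal p + (-1) ^ n * x) =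
        (goldenAlpha ^ n * (2 * goldenAlpha + 1)) * (x * Nat.fib n - k) := by
      linear_combination (-goldenAlpha ^ n) * hk - (-1) ^ n * goldenStar p * hab
        - goldenAlpha ^ n * x * hf - x * hab
    rw [← sub_nonneg (a := x + (-1) ^ n * goldenStar p), e,
      mul_nonneg_iff_of_pos_left (by positivity), sub_nonneg]
    obtain ⟨l, hl⟩ := Int.eq_ofNat_of_zero_le (by omega : 0 ≤ k)
    rw [hl, Int.cast_natCast]
    exact Int.ofNat_le.trans (Nat.le_floor_iff (by positivity))
  rw [IsNearPoint, ← hkdef, goldenVal_goldenMul_pow, ← h1, ← and_assoc, ← and_assoc]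
  exact and_congr_left' (and_congr_right h2)

/-- The α²ⁿ corrections are eventually too small to matter, unless x + σv* = 0; then the sign of v +
σx decides. -/
lemma eventually_isNearPoint_iff {x : ℝ} (hx : 0 ≤ x) (p : ℤ × ℤ) :
    ∀ᶠ n : ℕ in atTop, IsNearPoint ⌊x * (Nat.fib n : ℝ)⌋₊ ((goldenMul ^ n) p) ↔
      GoldenWindow ((-1) ^ n) x p := by
  have hα := goldenAlpha_pos
  have ht : Tendsto (fun n : ℕ => goldenAlpha ^ n) atTop (𝓝 0) :=
    tendsto_pow_atTop_nhds_zero_of_lt_one hα.le goldenAlpha_lt_one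
  have hsmall : ∀ c : ℝ, ∀ ε > 0, ∀ᶠ n : ℕ in atTop, |goldenAlpha ^ n * c| < ε := fun c ε hε => by
    have := (ht.mul_const c).abs
    rw [zero_mul, abs_zero] at this
    exact this.eventually_lt_const hε
  have hsmall2 : ∀ c : ℝ, ∀ ε > 0, ∀ᶠ n : ℕ in atTop, |(goldenAlpha ^ n) ^ 2 * c| < ε :=
    fun c ε hε => by
      have := ((ht.pow 2).mul_const c).abs
      rw [zero_pow two_ne_zero, zero_mul, abs_zero] at this
      exact this.eventually_lt_const hε
  have hzero : ∀ᶠ n : ℕ in atTop, goldenStar p ≠ 0 →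
      |(goldenAlpha ^ n) ^ 2 * goldenVal p| < |goldenStar p| := by
    by_cases h : goldenStar p = 0
    · simp [h]
    · filter_upwards [hsmall2 (goldenVal p) _ (abs_pos.2 h)] with n hn _ using hn
  have hedge : ∀ σ : ℝ, ∀ᶠ n : ℕ in atTop, x + σ * goldenStar p ≠ 0 →
      |(goldenAlpha ^ n) ^ 2 * (goldenVal p + σ * x)| < |x + σ * goldenStar p| := fun σ => by
    by_cases h : x + σ * goldenStar p = 0
    · simp [h]
    · filter_upwards [hsmall2 (goldenVal p + σ * x) _ (abs_pos.2 h)] with n hn _ using hn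
  filter_upwards [hzero, hedge 1, hedge (-1), hsmall (goldenVal p) (1 / 2) (by norm_num)]
    with n h0 h1 h2 h3
  have he : x + (-1) ^ n * goldenStar p ≠ 0 →
      |(goldenAlpha ^ n) ^ 2 * (goldenVal p + (-1) ^ n * x)| < |x + (-1) ^ n * goldenStar p| := by
    rcases neg_one_pow_eq_or ℝ n with h | h <;> rw [h] <;> assumption
  have hs : |goldenStar p| = |(-1) ^ n * goldenStar p| := by
    rw [abs_mul, abs_pow, abs_neg, abs_one, one_pow, one_mul]
  rw [hs] at h0
  have hpow : 0 < (goldenAlpha ^ n) ^ 2 := by positivity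
  rw [isNearPoint_goldenMul_pow_iff n hx, GoldenWindow]
  refine and_congr ?_ ?_
  · by_cases hp : goldenStar p = 0
    · obtain rfl := goldenStar_eq_zero hp
      simp [goldenVal, goldenStar]
    · have h4 := abs_lt.1 (h0 hp)
      rcases abs_cases ((-1) ^ n * goldenStar p) with ⟨e, _⟩ | ⟨e, _⟩ <;> rw [e] at h4 <;>
        constructor <;> intro h <;> linarith [h4.1, h4.2]
  · rw [and_iff_left h3]
    by_cases hp : x + (-1) ^ n * goldenStar p = 0
    · rw [hp]
      simp only [lt_irrefl, false_or, true_and]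
      rw [mul_nonpos_iff_pos_imp_nonpos]
      constructor
      · exact fun h => h.1 hpow
      · exact fun h => ⟨fun _ => h, fun _ => hpow.le⟩
    · have h4 := abs_lt.1 (he hp)
      simp only [hp, false_and, or_false]
      rcases abs_cases (x + (-1) ^ n * goldenStar p) with ⟨e, h5⟩ | ⟨e, h5⟩ <;> rw [e] at h4
      · exact ⟨fun _ => lt_of_le_of_ne h5 (Ne.symm hp), fun _ => h4.2.le⟩
      · constructor <;> intro h <;> linarith [h4.1, h4.2]

/-- The limit of the `p`-th term of the rescaled Birkhoff sum along indices of parity sign `σ`. -/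
noncomputable def limitTerm (σ y x : ℝ) (p : ℤ × ℤ) : ℝ :=
  open Classical in
  if GoldenWindow σ x p then
    -Real.pi / (Real.pi * (y + goldenVal p / (2 * goldenAlpha + 1))) ^ 2 else 0

lemma tendsto_fib_mul_sin (y v : ℝ) :
    Tendsto (fun n : ℕ => (Nat.fib n : ℝ) *
      Real.sin (Real.pi * (y / Nat.fib n + goldenAlpha ^ n * v))) atTop
      (𝓝 (Real.pi * (y + v / (2 * goldenAlpha + 1)))) := by
  have hα := goldenAlpha_pos
  have ht : Tendsto (fun n : ℕ => goldenAlpha ^ n) atTop (𝓝 0) :=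
    tendsto_pow_atTop_nhds_zero_of_lt_one hα.le goldenAlpha_lt_one
  have hfib : Tendsto (fun n : ℕ => (Nat.fib n : ℝ)) atTop atTop := by
    refine tendsto_natCast_atTop_atTop.comp
      (tendsto_atTop_mono' atTop ?_ tendsto_id)
    filter_upwards [eventually_ge_atTop 5] with n hn using Nat.le_fib_self hn
  have harg : Tendsto (fun n : ℕ => Real.pi * (y / Nat.fib n + goldenAlpha ^ n * v)) atTop
      (𝓝 0) := by
    have := ((hfib.const_div_atTop y).add (ht.mul_const v)).const_mul Real.pi
    simpa using this
  have hsinc : Tendsto (fun n : ℕ => Real.sinc (Real.pi * (y / Nat.fib n + goldenAlpha ^ n * v)))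
      atTop (𝓝 1) := by
    have := (Real.continuous_sinc.tendsto 0).comp harg
    rwa [Real.sinc_zero] at this
  have hlim : Tendsto (fun n : ℕ => (Nat.fib n : ℝ) * goldenAlpha ^ n) atTop
      (𝓝 (1 / (2 * goldenAlpha + 1))) := by
    simp_rw [fib_mul_goldenAlpha_pow, ← mul_pow]
    have h : Tendsto (fun n : ℕ => (-1 * goldenAlpha ^ 2) ^ n) atTop (𝓝 0) := by
      apply tendsto_pow_atTop_nhds_zero_of_abs_lt_one
      rw [neg_one_mul, abs_neg, abs_of_nonneg (by positivity)]
      exact pow_lt_one₀ hα.le goldenAlpha_lt_one two_ne_zero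
    simpa using (h.const_sub 1).div_const (2 * goldenAlpha + 1)
  have hmain := ((hlim.mul_const v).const_add y).const_mul Real.pi |>.mul hsinc
  rw [mul_one, one_div_mul_eq_div] at hmain
  refine hmain.congr' ?_
  filter_upwards [eventually_gt_atTop 0] with n hn
  have hq : (Nat.fib n : ℝ) ≠ 0 := by exact_mod_cast (Nat.fib_pos.2 hn).ne'
  have hsin : ∀ t : ℝ, Real.sin t = t * Real.sinc t := fun t => by
    by_cases h : t = 0
    · simp [h]
    · rw [Real.sinc_of_ne_zero h, mul_div_cancel₀ _ h]
  rw [hsin]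
  field_simp

lemma GoldenWindow.ne_zero {σ x : ℝ} {p : ℤ × ℤ} (h : GoldenWindow σ x p) : p ≠ 0 := by
  rintro rfl
  simpa [goldenStar] using h.1

lemma GoldenWindow.abs_goldenStar_le {σ x : ℝ} (hσ : |σ| = 1) {p : ℤ × ℤ}
    (h : GoldenWindow σ x p) : |goldenStar p| ≤ x := by
  have e : |goldenStar p| = |σ * goldenStar p| := by rw [abs_mul, hσ, one_mul]
  rw [e, abs_of_neg h.1]
  rcases h.2 with h | h <;> linarith

lemma tendsto_scaledTerm {u : ℕ → ℕ} (hu : Tendsto u atTop atTop) {σ : ℝ}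
    (hσ : ∀ m, (-1) ^ u m = σ) {y x : ℝ} (hy : |y| < 1 / 20) (hx : x ∈ Set.Icc (0 : ℝ) 1)
    (p : ℤ × ℤ) :
    Tendsto (fun m => scaledTerm (u m) y x p) atTop (𝓝 (limitTerm σ y x p)) := by
  have hev := hu.eventually (eventually_isNearPoint_iff hx.1 p)
  simp only [hσ] at hev
  unfold limitTerm
  split_ifs with h
  · have hσ1 : |σ| = 1 := by rw [← hσ 0, abs_pow, abs_neg, abs_one, one_pow]
    -- No pole: |v| ≥ 1 because |v*| ≤ 1, whereas |y|(2α + 1) < 1.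
    have hw : Real.pi * (y + goldenVal p / (2 * goldenAlpha + 1)) ≠ 0 := by
      have h1 := one_le_abs_goldenVal_mul_abs_goldenStar h.ne_zero
      have h2 := (h.abs_goldenStar_le hσ1).trans hx.2
      have h3 : 1 ≤ |goldenVal p| := by nlinarith [abs_nonneg (goldenVal p)]
      have hr : 0 < 2 * goldenAlpha + 1 := by linarith [goldenAlpha_pos]
      refine mul_ne_zero Real.pi_ne_zero fun h0 => ?_
      have h4 : |goldenVal p| = |y| * (2 * goldenAlpha + 1) := by
        have h5 : goldenVal p = -(y * (2 * goldenAlpha + 1)) := by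
          field_simp at h0
          linarith
        rw [h5, abs_neg, abs_mul, abs_of_pos hr]
      nlinarith [goldenAlpha_lt_five_eighths, abs_nonneg y]
    have hl := (tendsto_const_nhds (x := -Real.pi)).div
      (((tendsto_fib_mul_sin y (goldenVal p)).comp hu).pow 2) (pow_ne_zero 2 hw)
    refine hl.congr' ?_
    filter_upwards [hev] with m hm
    rw [scaledTerm, if_pos (hm.2 h)]
    simp only [Function.comp, Pi.div_apply, cotDeriv]
    rw [div_pow, one_pow, mul_one_div, div_div, mul_pow, mul_comm (Real.sin _ ^ 2)]
  · refine tendsto_const_nhds.congr' ?_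
    filter_upwards [hev] with m hm
    rw [scaledTerm, if_neg (mt hm.1 h)]

/-! ### Convergence and monotonicity of the sums -/

lemma tendsto_scaledCscSum {u : ℕ → ℕ} (hu : Tendsto u atTop atTop) {σ : ℝ}
    (hσ : ∀ m, (-1) ^ u m = σ) {y x : ℝ} (hy : |y| < 1 / 20) (hx : x ∈ Set.Icc (0 : ℝ) 1) :
    Tendsto (fun m => scaledCscSum (u m) y x) atTop (𝓝 (∑' p, limitTerm σ y x p)) := by
  simp_rw [scaledCscSum_eq_tsum]
  refine tendsto_tsum_of_dominated_convergence (summable_stripInvSq.mul_left (144 * Real.pi))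
    (tendsto_scaledTerm hu hσ hy hx) ?_
  filter_upwards [hu.eventually (eventually_ne_atTop 0)] with m hm p
    using norm_scaledTerm_le hm hy hx.2 p

lemma cotDeriv_nonpos (t : ℝ) : cotDeriv t ≤ 0 :=
  mul_nonpos_of_nonpos_of_nonneg (neg_nonpos.2 Real.pi_pos.le) (sq_nonneg _)

lemma antitone_scaledCscSum (n : ℕ) (y : ℝ) : Antitone (scaledCscSum n y) := by
  intro x x' h
  unfold scaledCscSum cscBirkhoffSum
  refine div_le_div_of_nonneg_right ?_ (by positivity)
  rw [← neg_le_neg_iff, ← Finset.sum_neg_distrib, ← Finset.sum_neg_distrib]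
  exact Finset.sum_le_sum_of_subset_of_nonneg
    (Finset.Icc_subset_Icc_right (Nat.floor_le_floor (by gcongr)))
    fun k _ _ => neg_nonneg.2 (cotDeriv_nonpos _)

lemma antitoneOn_of_tendsto {u : ℕ → ℕ} {y : ℝ} {S : ℝ → ℝ} {t : Set ℝ}
    (h : ∀ x ∈ t, Tendsto (fun m => scaledCscSum (u m) y x) atTop (𝓝 (S x))) :
    AntitoneOn S t := fun _ hx _ hx' hxx' =>
  le_of_tendsto_of_tendsto' (h _ hx') (h _ hx) fun m => antitone_scaledCscSum (u m) y hxx'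

/-! ### The limit at `y = 0` and its self-similarity -/

/-- The `p`-th term of the right-continuous limit at `y = 0`. -/
noncomputable def selfSimilarTerm (x : ℝ) (p : ℤ × ℤ) : ℝ :=
  open Classical in
  if 0 < goldenStar p ∧ goldenStar p ≤ x then
    -Real.pi / (Real.pi * (goldenVal p / (2 * goldenAlpha + 1))) ^ 2 else 0

lemma selfSimilarTerm_nonpos (x : ℝ) (p : ℤ × ℤ) : selfSimilarTerm x p ≤ 0 := by
  unfold selfSimilarTerm
  split_ifs
  · exact div_nonpos_of_nonpos_of_nonneg (neg_nonpos.2 Real.pi_pos.le) (sq_nonneg _)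
  · rfl

lemma norm_selfSimilarTerm_le {x : ℝ} (hx : x ≤ 5 / 2) (p : ℤ × ℤ) :
    ‖selfSimilarTerm x p‖ ≤ (2 * goldenAlpha + 1) ^ 2 / Real.pi * stripInvSq p := by
  have hπ := Real.pi_pos
  have hα := goldenAlpha_pos
  unfold selfSimilarTerm
  split_ifs with h
  · have hp : p ≠ 0 := by
      rintro rfl
      simpa [goldenStar] using h.1
    have hv : goldenVal p ≠ 0 := fun h => hp (goldenVal_eq_zero h)
    rw [stripInvSq, if_pos ⟨hp, by rw [abs_of_pos h.1]; linarith [h.2]⟩, norm_div, norm_neg,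
      Real.norm_of_nonneg hπ.le, Real.norm_of_nonneg (sq_nonneg _)]
    apply le_of_eq
    field_simp
  · rw [norm_zero]
    exact mul_nonneg (by positivity) (stripInvSq_nonneg p)

lemma summable_selfSimilarTerm {x : ℝ} (hx : x ≤ 5 / 2) : Summable (selfSimilarTerm x) :=
  Summable.of_norm_bounded (summable_stripInvSq.mul_left _) (norm_selfSimilarTerm_le hx)

/-- The limit function `s'` at `y = 0`, in its right-continuous version. -/
noncomputable def selfSimilarLimit (x : ℝ) : ℝ := ∑' p, selfSimilarTerm x p

lemma antitoneOn_selfSimilarLimit : AntitoneOn selfSimilarLimit (Set.Icc 0 1) := by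
  intro x hx x' hx' h
  refine (summable_selfSimilarTerm (by linarith [hx'.2])).tsum_le_tsum (fun p => ?_)
    (summable_selfSimilarTerm (by linarith [hx.2]))
  by_cases hp : 0 < goldenStar p ∧ goldenStar p ≤ x
  · rw [selfSimilarTerm, selfSimilarTerm, if_pos hp, if_pos ⟨hp.1, hp.2.trans h⟩]
  · rw [selfSimilarTerm.eq_def x, if_neg hp]
    exact selfSimilarTerm_nonpos _ _

/-- The closed condition v* ≤ x makes every term constant just to the right of x. -/
lemma continuousWithinAt_selfSimilarLimit {x : ℝ} (hx : x < 1) :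
    ContinuousWithinAt selfSimilarLimit (Set.Ici x) x := by
  refine tendsto_tsum_of_dominated_convergence
    (summable_stripInvSq.mul_left ((2 * goldenAlpha + 1) ^ 2 / Real.pi)) (fun p => ?_) ?_
  · refine tendsto_const_nhds.congr' ?_
    by_cases hp : goldenStar p ≤ x
    · filter_upwards [self_mem_nhdsWithin] with z hz
      simp only [selfSimilarTerm, hp, hp.trans hz]
    · filter_upwards [mem_nhdsWithin_of_mem_nhds (Iio_mem_nhds (not_le.1 hp))] with z hz
      simp only [selfSimilarTerm, hp, not_le.2 (Set.mem_Iio.1 hz)]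
  · filter_upwards [mem_nhdsWithin_of_mem_nhds (Iio_mem_nhds hx)] with z hz p
    exact norm_selfSimilarTerm_le (by linarith [Set.mem_Iio.1 hz]) p

lemma limitTerm_eq_selfSimilarTerm {x : ℝ} (hx : x ∈ goldenIntegers → x = 0 ∨ x = 1)
    (p : ℤ × ℤ) :
    -- The sign change reflects the even window onto the odd one.
    limitTerm 1 0 x (-p) = selfSimilarTerm x p ∧ limitTerm (-1) 0 x p = selfSimilarTerm x p := by
  -- A tie puts x in `ℤ[α]`, hence x = 1 and p = (1, 0); there v = v* = x, so both parities include
  -- the endpoint.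
  have key : 0 < goldenStar p → x = goldenStar p → goldenVal p = x := by
    intro h0 hxp
    have hx1 : x = 1 := by
      refine (hx ⟨p.1 - p.2, -p.2, ?_⟩).resolve_left (by linarith)
      rw [hxp, goldenStar]
      push_cast
      ring
    have hp : p - (1, 0) = 0 := goldenStar_eq_zero (by
      have h1 : goldenStar p = 1 := hxp.symm.trans hx1
      simp only [goldenStar, Prod.fst_sub, Prod.snd_sub] at h1 ⊢
      push_cast
      linarith)
    rw [sub_eq_zero.1 hp, hx1]
    simp [goldenVal]
  have hiff : ∀ c : ℝ, (c = goldenVal p - x ∨ c = x - goldenVal p) →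
      ((-goldenStar p < 0 ∧ (0 < x + -goldenStar p ∨ x + -goldenStar p = 0 ∧ c ≤ 0)) ↔
        0 < goldenStar p ∧ goldenStar p ≤ x) := fun c hc => by
    rw [neg_lt_zero]
    refine and_congr_right fun h0 => ⟨by rintro (h | h) <;> linarith, fun h => ?_⟩
    rcases h.lt_or_eq with h | h
    · exact Or.inl (by linarith)
    · have := key h0 h.symm
      exact Or.inr ⟨by linarith, by rcases hc with rfl | rfl <;> linarith⟩
  constructor
  · have h : GoldenWindow 1 x (-p) ↔ 0 < goldenStar p ∧ goldenStar p ≤ x := by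
      rw [GoldenWindow, goldenStar_neg, goldenVal_neg, one_mul]
      exact hiff _ (Or.inr (by ring))
    simp only [limitTerm, selfSimilarTerm, h, goldenVal_neg]
    congr 1
    ring
  · have h : GoldenWindow (-1) x p ↔ 0 < goldenStar p ∧ goldenStar p ≤ x := by
      rw [GoldenWindow, neg_one_mul]
      exact hiff _ (Or.inl (by ring))
    simp only [limitTerm, selfSimilarTerm, h, zero_add]

lemma tsum_limitTerm_eq_selfSimilarLimit {x : ℝ} (hx : x ∈ goldenIntegers → x = 0 ∨ x = 1) :
    ∑' p, limitTerm 1 0 x p = selfSimilarLimit x ∧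
      ∑' p, limitTerm (-1) 0 x p = selfSimilarLimit x := by
  refine ⟨?_, tsum_congr fun p => (limitTerm_eq_selfSimilarTerm hx p).2⟩
  rw [← (Equiv.neg (ℤ × ℤ)).tsum_eq]
  exact tsum_congr fun p => (limitTerm_eq_selfSimilarTerm hx p).1

/-- Under p ↦ -αp the conjugate is multiplied by 1 + α = 1/α and stays positive, while 1/v² gains a
factor 1/α². -/
lemma selfSimilarLimit_goldenAlpha_mul (x : ℝ) :
    selfSimilarLimit (goldenAlpha * x) = goldenAlpha ^ 2 * selfSimilarLimit x := by
  have hα := goldenAlpha_pos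
  have hβ : (1 + goldenAlpha) * goldenAlpha = 1 := by linarith [goldenAlpha_sq]
  unfold selfSimilarLimit
  rw [← tsum_mul_left, ← (goldenMul.trans (Equiv.neg _)).tsum_eq fun p => _ * selfSimilarTerm x p]
  refine tsum_congr fun p => ?_
  have hiff : (0 < (1 + goldenAlpha) * goldenStar p ∧ (1 + goldenAlpha) * goldenStar p ≤ x) ↔
      (0 < goldenStar p ∧ goldenStar p ≤ goldenAlpha * x) := by
    refine and_congr (mul_pos_iff_of_pos_left (by linarith)) ?_
    rw [← mul_le_mul_iff_of_pos_left hα, ← mul_assoc, mul_comm goldenAlpha, hβ, one_mul]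
  simp only [selfSimilarTerm, Equiv.trans_apply, Equiv.neg_apply, goldenStar_neg, goldenVal_neg,
    goldenStar_goldenMul, goldenVal_goldenMul, neg_mul, neg_neg, hiff]
  split_ifs
  · field_simp
  · rw [mul_zero]

theorem mainTheorem5 :
    ∃ δ : ℝ, 0 < δ ∧ ∃ sEven sOdd : ℝ → ℝ → ℝ,
      -- for small `|y|`, pointwise convergence along even and odd indices, to monotone functions
      (∀ y : ℝ, |y| < δ →
        (∀ x ∈ Set.Icc (0 : ℝ) 1,
          Tendsto (fun m : ℕ => scaledCscSum (2 * m) y x) atTop (𝓝 (sEven y x)) ∧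
          Tendsto (fun m : ℕ => scaledCscSum (2 * m + 1) y x) atTop (𝓝 (sOdd y x))) ∧
        AntitoneOn (sEven y) (Set.Icc 0 1) ∧ AntitoneOn (sOdd y) (Set.Icc 0 1)) ∧
      -- for `y = 0`, the common limit (off its jump set) and its self-similarity
      ∃ s : ℝ → ℝ,
        AntitoneOn s (Set.Icc 0 1) ∧
        (∀ x ∈ Set.Ico (0 : ℝ) 1, ContinuousWithinAt s (Set.Ici x) x) ∧
        (∀ x ∈ Set.Icc (0 : ℝ) 1, (x ∈ goldenIntegers → x = 0 ∨ x = 1) →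
          sEven 0 x = s x ∧ sOdd 0 x = s x) ∧
        (∀ x ∈ Set.Icc (0 : ℝ) 1, s (goldenAlpha * x) = goldenAlpha ^ 2 * s x) := by
  have hu0 : Tendsto (fun m : ℕ => 2 * m) atTop atTop :=
    tendsto_atTop_mono (fun m => by simp only [id]; omega) tendsto_id
  have hu1 : Tendsto (fun m : ℕ => 2 * m + 1) atTop atTop :=
    tendsto_atTop_mono (fun m => by simp only [id]; omega) tendsto_id
  refine ⟨1 / 20, by norm_num, fun y x => ∑' p, limitTerm 1 y x p,
    fun y x => ∑' p, limitTerm (-1) y x p, fun y hy => ?_, selfSimilarLimit,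
    antitoneOn_selfSimilarLimit, fun x hx => continuousWithinAt_selfSimilarLimit hx.2,
    fun x _ hx => tsum_limitTerm_eq_selfSimilarLimit hx,
    fun x _ => selfSimilarLimit_goldenAlpha_mul x⟩
  have heven := fun x (hx : x ∈ Set.Icc (0 : ℝ) 1) =>
    tendsto_scaledCscSum hu0 (σ := 1) (fun m => by simp) hy hx
  have hodd := fun x (hx : x ∈ Set.Icc (0 : ℝ) 1) =>
    tendsto_scaledCscSum hu1 (σ := -1) (fun m => by simp [pow_succ]) hy hx
  exact ⟨fun x hx => ⟨heven x hx, hodd x hx⟩, antitoneOn_of_tendsto heven,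
    antitoneOn_of_tendsto hodd⟩
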